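/- Let $S$ be a complete separable metric space, let $a,k,\rho>0$, and write $x_{(\beta)}=\Gamma(x+\beta)/\Gamma(x)$ for $x>0$, $\beta\ge 0$, and $x_{(n)}=x(x+1)\cdots(x+n-1)$ for $x\ge 0$ and integers $n\ge 0$ (so $0_{(0)}=1$ and $0_{(n)}=0$ for $n\ge1$). For $\kappa_1,\dots,\kappa_l\ge0$ the multivariate generalized Waring distribution $\mathrm{MGWD}(a;\kappa_1,\dots,\kappa_l;\rho)$ is the distribution on $\mathbb{Z}_{\ge0}^l$ with probability function $$\frac{\rho_{(\sum_i \kappa_i)}\,a_{(\sum_i n_i)}}{(\rho+a)_{(\sum_i \kappa_i+\sum_i n_i)}}\prod_{i=1}^l\frac{(\kappa_i)_{(n_i)}}{n_i!}.$$ Let $N$ be a point process on $S$, that is, a random integer-valued measure on the Borel sets of $S$ defined on a probability space, and suppose that (I) $N$ is almost surely boundedly finite (finite on all bounded Borel sets) and has no fixed atoms, i.e. $P\{N(\{x\})>0\}=0$ for every $x\in S$; (II) the finite dimensional distributions of $N$ are of generalized Waring form: for every finite family $A_1,\dots,A_l$ of pairwise disjoint bounded Borel sets there are numbers $\mu_1,\dots,\mu_l\in[0,\infty)$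 such that $(N(A_1),\dots,N(A_l))$ has the distribution $\mathrm{MGWD}(a;k\mu_1,\dots,k\mu_l;\rho)$. Then there exists a boundedly finite nonatomic Borel measure $\mu$ on $S$ such that $$P_0(A)=P\{N(A)=0\}=\frac{\rho_{(k\mu(A))}}{(\rho+a)_{(k\mu(A))}}\qquad\text{for every bounded Borel set }A,$$ and such that, whenever $A_1,\dots,A_l$ are pairwise disjoint bounded Borel sets and $(N(A_1),\dots,N(A_l))$ has the distribution $\mathrm{MGWD}(a;k\mu_1,\dots,k\mu_l;\rho)$ with $\mu_1,\dots,\mu_l\in[0,\infty)$, one has $\mu(A_i)=\mu_i$ for $i=1,\dots,l$. -/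

import Mathlib

open MeasureTheory
open scoped ENNReal NNReal

noncomputable section

/-- The ascending factorial `x_(β) = Γ(x + β) / Γ(x)` of real order `β ≥ 0`, for a base `x > 0`. -/
def gammaRising (x β : ℝ) : ℝ := Real.Gamma (x + β) / Real.Gamma x

/-- For natural orders and positive bases, `x_(n)` is the ascending factorial
`x (x + 1) ⋯ (x + n - 1)`. The latter also covers the base `0`
(`0_(0) = 1` and `0_(n) = 0` for `n ≥ 1`), where the quotient of Gamma values is undefined. -/
theorem gammaRising_natCast {x : ℝ} (hx : 0 < x) (n : ℕ) :
    gammaRising x n = (ascPochhammer ℝ n).eval x := by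
  have hΓ : Real.Gamma x ≠ 0 := (Real.Gamma_pos_of_pos hx).ne'
  induction n with
  | zero => simp [gammaRising, hΓ]
  | succ n ih =>
    have h : x + n ≠ 0 := by positivity
    rw [ascPochhammer_succ_eval, ← ih, gammaRising, gammaRising, Nat.cast_succ, ← add_assoc,
      Real.Gamma_add_one h]
    ring

/-- The probability function of the multivariate generalized Waring distribution
`MGWD(a; κ₁, …, κ_l; ρ)`:
`ρ_(∑ κᵢ) a_(∑ nᵢ) / (ρ + a)_(∑ κᵢ + ∑ nᵢ) * ∏ (κᵢ)_(nᵢ) / nᵢ!`,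
for `a, ρ > 0` and `κᵢ ≥ 0` (a component with `κᵢ = 0` is identically zero). -/
def mgwdPmf (a ρ : ℝ) {l : ℕ} (κ : Fin l → ℝ) (n : Fin l → ℕ) : ℝ :=
  gammaRising ρ (∑ i, κ i) * (ascPochhammer ℝ (∑ i, n i)).eval a
      / gammaRising (ρ + a) (∑ i, κ i + ∑ i, (n i : ℝ))
    * ∏ i, (ascPochhammer ℝ (n i)).eval (κ i) / ((n i).factorial : ℝ)

/-- A Borel measure that is finite on bounded Borel sets. -/
def BoundedlyFinite {S : Type*} [MetricSpace S] [MeasurableSpace S] (ν : Measure S) : Prop :=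
  ∀ A : Set S, MeasurableSet A → Bornology.IsBounded A → ν A < ∞

/-- A measure whose values on bounded Borel sets are nonnegative integers (or `∞`). -/
def IntegerValued {S : Type*} [MetricSpace S] [MeasurableSpace S] (ν : Measure S) : Prop :=
  ∀ A : Set S, MeasurableSet A → Bornology.IsBounded A → ∃ n : ℕ∞, ν A = (n : ℝ≥0∞)

/-- `N` is an almost surely boundedly finite point process: a random measure (measurable for the
σ-algebra generated by the evaluations at Borel sets) that almost surely is boundedly finite and
integer valued. -/
structure IsPointProcess {Ω S : Type*} [MeasurableSpace Ω] [MetricSpace S] [MeasurableSpace S]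
    (P : Measure Ω) (N : Ω → Measure S) : Prop where
  measurable : Measurable N
  integerValued : ∀ᵐ ω ∂P, IntegerValued (N ω)
  boundedlyFinite : ∀ᵐ ω ∂P, BoundedlyFinite (N ω)

/-- No point is charged by `N` with positive probability. -/
def NoFixedAtoms {Ω S : Type*} [MeasurableSpace Ω] [MeasurableSpace S]
    (P : Measure Ω) (N : Ω → Measure S) : Prop :=
  ∀ x : S, P {ω | 0 < N ω {x}} = 0

/-- A finite family of pairwise disjoint bounded Borel sets. -/
def IsFidiFamily {S : Type*} [MetricSpace S] [MeasurableSpace S] {l : ℕ}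
    (A : Fin l → Set S) : Prop :=
  (∀ i, MeasurableSet (A i)) ∧ (∀ i, Bornology.IsBounded (A i)) ∧
    Pairwise fun i j => Disjoint (A i) (A j)

/-- The joint distribution of `N(A₁), …, N(A_l)` is `MGWD(a; k m₁, …, k m_l; ρ)`. -/
def HasWaringLaw {Ω S : Type*} [MeasurableSpace Ω] [MeasurableSpace S]
    (P : Measure Ω) (N : Ω → Measure S) (a k ρ : ℝ) {l : ℕ}
    (A : Fin l → Set S) (m : Fin l → ℝ≥0) : Prop :=
  ∀ n : Fin l → ℕ,
    P.real {ω | ∀ i, N ω (A i) = (n i : ℝ≥0∞)} = mgwdPmf a ρ (fun i => k * (m i : ℝ)) n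

/-- The finite dimensional distributions of `N` over disjoint bounded Borel sets are of
generalized Waring form. The parameters `mᵢ` may depend on the whole family; no measure
is presupposed. -/
def HasWaringFidi {Ω S : Type*} [MeasurableSpace Ω] [MetricSpace S] [MeasurableSpace S]
    (P : Measure Ω) (N : Ω → Measure S) (a k ρ : ℝ) : Prop :=
  ∀ (l : ℕ) (A : Fin l → Set S), IsFidiFamily A →
    ∃ m : Fin l → ℝ≥0, HasWaringLaw P N a k ρ A m

end

/-!
The void probability of a bounded Borel set `A` is `φ (k * t)`, where `t` is the Waring parameter of
`N(A)` and `φ t = ρ_(t) / (ρ + a)_(t) = B(ρ + t, a) / B(ρ, a)` (`waringVoid`). As `φ` is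
continuous and strictly decreasing, the void probability determines a number `m A`, and properties
of void probabilities turn into properties of `m`.

The parameters in the fidi hypothesis may depend on the whole family, so they first have to be shown
to equal `m (A i)`. For a pair `A, B`, summing the joint probability function over the values of
`N(B)` at `N(A) = 0` is Gauss's summation theorem (`hasSum_ascPochhammer_mul_beta`), obtained by
integrating the binomial series against a Beta density; this gives the first parameter
(`HasWaringLaw.real_fst_eq_zero`). A general family is compared with the pair formed by `A i` and
the union of the other sets, through the events that `A i` has zero or one point and the other sets
have none (`HasWaringLaw.real_eq_zero`).

Since `N` vanishes on a finite disjoint union exactly when it vanishes on every member, and that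
joint probability is `φ` of the sum of the parameters, `m` is finitely additive. Continuity from above
of `P` along the void events of partial unions makes it countably additive on bounded Borel sets,
and it extends to a Borel measure by cutting the space into countably many bounded shells
(`exists_measure_eq_of_isBounded`). A point that is not a fixed atom has void probability `1 = φ 0`, so
its mass is `0`.
-/

open Set Filter Topology ProbabilityTheory Bornology

/-! ### Beta integrals and the void probabilities of the Waring law -/

theorem lintegral_rpow_mul_one_sub_rpow {p q : ℝ} (hp : 0 < p) (hq : 0 < q) :
    ∫⁻ u : ℝ in Ioo 0 1, ENNReal.ofReal (u ^ (p - 1) * (1 - u) ^ (q - 1))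
      = ENNReal.ofReal (beta p q) := by
  have h1 := lintegral_betaPDF_eq_one hp hq
  have hB := beta_pos hp hq
  rw [lintegral_betaPDF] at h1
  simp_rw [mul_assoc] at h1
  simp_rw [ENNReal.ofReal_mul (one_div_pos.2 hB).le] at h1
  rw [lintegral_const_mul' _ _ ENNReal.ofReal_ne_top] at h1
  have h2 : ENNReal.ofReal (beta p q) * ENNReal.ofReal (1 / beta p q) = 1 := by
    rw [← ENNReal.ofReal_mul hB.le, mul_one_div_cancel hB.ne', ENNReal.ofReal_one]
  calc _ = ENNReal.ofReal (beta p q) * ENNReal.ofReal (1 / beta p q) * _ := by rw [h2, one_mul]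
    _ = _ := by rw [mul_assoc, h1, mul_one]

/-- The binomial series `∑ (κ)_(n) / n! * x ^ n = (1 - x) ^ (-κ)`. -/
theorem hasSum_ascPochhammer_mul_pow (κ : ℝ) {x : ℝ} (hx0 : 0 < x) (hx1 : x < 1) :
    HasSum (fun n : ℕ => (ascPochhammer ℝ n).eval κ / (n.factorial : ℝ) * x ^ n)
      ((1 - x) ^ (-κ)) := by
  have h := (Real.one_div_one_sub_rpow_hasFPowerSeriesOnBall_zero κ).hasSum (y := x) (by
    rw [← ENNReal.ofReal_one, Metric.eball_ofReal]
    simpa [abs_of_pos hx0] using hx1)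
  simp only [zero_add] at h
  rw [Real.rpow_neg (by linarith), ← one_div]
  convert! h using 2 with n
  have hc : (ascPochhammer ℝ n).eval κ = n.factorial * Ring.choose (κ + n - 1) n := by
    rw [← Polynomial.ascPochhammer_smeval_eq_eval, Polynomial.ascPochhammer_smeval_cast,
      ← Ring.factorial_nsmul_multichoose_eq_ascPochhammer, nsmul_eq_mul, Ring.multichoose_eq]
  rw [hc, mul_div_cancel_left₀ _ (by positivity)]
  simp [FormalMultilinearSeries.ofScalars]

theorem ascPochhammer_eval_nonneg {κ : ℝ} (hκ : 0 ≤ κ) (n : ℕ) :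
    0 ≤ (ascPochhammer ℝ n).eval κ := by
  induction n with
  | zero => simp
  | succ n ih => rw [ascPochhammer_succ_eval]; positivity

/-- Gauss's summation theorem in terms of the Beta function: expand `u ^ (-κ)` in powers of
`1 - u` under the Beta integral. -/
theorem hasSum_ascPochhammer_mul_beta {p q κ : ℝ} (hp : 0 < p) (hq : 0 < q) (hκ : 0 ≤ κ) :
    HasSum (fun n : ℕ => (ascPochhammer ℝ n).eval κ / (n.factorial : ℝ) * beta (p + κ) (q + n))
      (beta p q) := by
  set c : ℕ → ℝ := fun n => (ascPochhammer ℝ n).eval κ / (n.factorial : ℝ) with hc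
  have hc0 (n) : 0 ≤ c n := div_nonneg (ascPochhammer_eval_nonneg hκ n) (by positivity)
  have hb0 (n : ℕ) : 0 < beta (p + κ) (q + n) := beta_pos (by positivity) (by positivity)
  have key : ∑' n, ENNReal.ofReal (c n * beta (p + κ) (q + n)) = ENNReal.ofReal (beta p q) := by
    rw [← lintegral_rpow_mul_one_sub_rpow hp hq]
    have h (n : ℕ) : ENNReal.ofReal (c n * beta (p + κ) (q + n)) =
        ∫⁻ u : ℝ in Ioo 0 1,
          ENNReal.ofReal (c n * (u ^ (p + κ - 1) * (1 - u) ^ (q + n - 1))) := by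
      simp_rw [ENNReal.ofReal_mul (hc0 n)]
      rw [lintegral_const_mul' _ _ ENNReal.ofReal_ne_top,
        lintegral_rpow_mul_one_sub_rpow (by positivity) (by positivity)]
    simp_rw [h]
    rw [← lintegral_tsum fun n => by fun_prop]
    refine setLIntegral_congr_fun measurableSet_Ioo fun u hu => ?_
    have hu0 : 0 < u := hu.1
    have hu1 : 0 < 1 - u := sub_pos.2 hu.2
    have hs := (hasSum_ascPochhammer_mul_pow κ hu1 (by linarith)).mul_right
      (u ^ (p + κ - 1) * (1 - u) ^ (q - 1))
    rw [sub_sub_cancel, ← mul_assoc, ← Real.rpow_add hu0] at hs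
    have hs' : HasSum (fun n => c n * (u ^ (p + κ - 1) * (1 - u) ^ (q + n - 1)))
        (u ^ (p - 1) * (1 - u) ^ (q - 1)) := by
      rw [show -κ + (p + κ - 1) = p - 1 by ring] at hs
      convert! hs using 2 with n
      rw [show q + n - 1 = (q - 1) + n by ring, Real.rpow_add hu1, Real.rpow_natCast]
      ring
    rw [← hs'.tsum_eq, ENNReal.ofReal_tsum_of_nonneg _ hs'.summable]
    intro n
    have := hc0 n
    positivity
  have hnn (n : ℕ) : 0 ≤ c n * beta (p + κ) (q + n) := mul_nonneg (hc0 n) (hb0 n).le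
  have hsum : Summable fun n => c n * beta (p + κ) (q + n) := by
    have h : ∑' n, ENNReal.ofReal (c n * beta (p + κ) (q + n)) ≠ ∞ := by simp [key]
    simpa [ENNReal.toReal_ofReal, hnn] using ENNReal.summable_toReal h
  rw [← ENNReal.ofReal_tsum_of_nonneg hnn hsum, ENNReal.ofReal_eq_ofReal_iff (tsum_nonneg hnn)
    (beta_pos hp hq).le] at key
  exact key ▸ hsum.hasSum

theorem beta_add_left_lt {p q κ : ℝ} (hp : 0 < p) (hq : 0 < q) (hκ : 0 < κ) :
    beta (p + κ) q < beta p q := by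
  have h := hasSum_ascPochhammer_mul_beta hp hq hκ.le
  have hle := sum_le_hasSum (Finset.range 2) (fun n _ => ?_) h
  · have h1 : 0 < beta (p + κ) (q + 1) := beta_pos (by positivity) (by positivity)
    simp [Finset.sum_range_succ] at hle
    nlinarith
  · exact mul_nonneg (div_nonneg (ascPochhammer_eval_nonneg hκ.le n) (by positivity))
      (beta_pos (by positivity) (by positivity)).le

/-- The probability `ρ_(t) / (ρ + a)_(t)` that a generalized Waring variable with parameters
`a, t, ρ` vanishes. -/
noncomputable def waringVoid (a ρ t : ℝ) : ℝ := gammaRising ρ t / gammaRising (ρ + a) t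

section WaringVoid

variable {a ρ : ℝ}

theorem waringVoid_eq_beta (ha : 0 < a) (hρ : 0 < ρ) {t : ℝ} (ht : 0 ≤ t) :
    waringVoid a ρ t = beta (ρ + t) a / beta ρ a := by
  have h1 := (Real.Gamma_pos_of_pos hρ).ne'
  have h2 := (Real.Gamma_pos_of_pos ha).ne'
  have h3 := (Real.Gamma_pos_of_pos (add_pos hρ ha)).ne'
  have h4 := (Real.Gamma_pos_of_pos (by positivity : 0 < ρ + a + t)).ne'
  rw [waringVoid, gammaRising, gammaRising, beta, beta, add_right_comm ρ t a]
  field_simp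

theorem waringVoid_zero (ha : 0 < a) (hρ : 0 < ρ) : waringVoid a ρ 0 = 1 := by
  rw [waringVoid_eq_beta ha hρ le_rfl, add_zero, div_self (beta_pos hρ ha).ne']

theorem waringVoid_strictAntiOn (ha : 0 < a) (hρ : 0 < ρ) :
    StrictAntiOn (waringVoid a ρ) (Ici 0) := by
  intro s hs t ht hst
  rw [mem_Ici] at hs ht
  rw [waringVoid_eq_beta ha hρ hs, waringVoid_eq_beta ha hρ ht]
  have := beta_add_left_lt (p := ρ + s) (q := a) (κ := t - s) (by positivity) ha (by linarith)
  rw [add_add_sub_cancel] at this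
  exact div_lt_div_of_pos_right this (beta_pos hρ ha)

theorem continuousAt_waringVoid (ha : 0 < a) (hρ : 0 < ρ) {t : ℝ} (ht : 0 ≤ t) :
    ContinuousAt (waringVoid a ρ) t := by
  have hc {x : ℝ} (hx : 0 < x) : ContinuousAt (gammaRising x) t := by
    have h : ContinuousAt Real.Gamma (x + t) :=
      (Real.differentiableOn_Gamma_Ioi.differentiableAt
        (Ioi_mem_nhds (by positivity : 0 < x + t))).continuousAt
    exact (ContinuousAt.comp' h (by fun_prop)).div_const _
  refine (hc hρ).div (hc (add_pos hρ ha)) (div_pos ?_ ?_).ne' <;>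
    exact Real.Gamma_pos_of_pos (by positivity)

theorem mgwdPmf_single {l : ℕ} (κ : Fin l → ℝ) (i : Fin l) (p : ℕ) :
    mgwdPmf a ρ κ (Pi.single i p) =
      gammaRising ρ (∑ j, κ j) * (ascPochhammer ℝ p).eval a
        / gammaRising (ρ + a) (∑ j, κ j + p) * ((ascPochhammer ℝ p).eval (κ i) / p.factorial) := by
  have h1 : ∑ j, (Pi.single i p : Fin l → ℕ) j = p := by simp
  have h2 : ∑ j, ((Pi.single i p : Fin l → ℕ) j : ℝ) = p := by rw [← Nat.cast_sum, h1]
  rw [mgwdPmf, h1, h2, Finset.prod_eq_single i]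
  · simp
  · intro j _ hj
    simp [hj]
  · simp

theorem mgwdPmf_zero {l : ℕ} (κ : Fin l → ℝ) :
    mgwdPmf a ρ κ 0 = waringVoid a ρ (∑ j, κ j) := by
  simp [mgwdPmf, waringVoid]

/-- The first marginal of a bivariate generalized Waring law vanishes with the probability
given by its own parameter. -/
theorem hasSum_mgwdPmf_pair (ha : 0 < a) (hρ : 0 < ρ) {κ : Fin 2 → ℝ} (hκ : ∀ j, 0 ≤ κ j) :
    HasSum (fun n : ℕ => mgwdPmf a ρ κ (Pi.single 1 n)) (waringVoid a ρ (κ 0)) := by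
  rw [waringVoid_eq_beta ha hρ (hκ 0)]
  have h0 := hκ 0
  have h1 := hκ 1
  convert! (hasSum_ascPochhammer_mul_beta (p := ρ + κ 0) (q := a) (κ := κ 1) (by positivity) ha
    h1).div_const (beta ρ a) using 2 with n
  have g1 := (Real.Gamma_pos_of_pos hρ).ne'
  have g2 := (Real.Gamma_pos_of_pos ha).ne'
  have g3 := (Real.Gamma_pos_of_pos (add_pos hρ ha)).ne'
  have g4 := (Real.Gamma_pos_of_pos (by positivity : 0 < ρ + a + (κ 0 + κ 1 + n))).ne'
  rw [mgwdPmf_single, ← gammaRising_natCast ha, Fin.sum_univ_two]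
  simp only [gammaRising, beta]
  rw [show ρ + κ 0 + κ 1 + (a + n) = ρ + a + (κ 0 + κ 1 + n) by ring,
    show ρ + κ 0 + κ 1 = ρ + (κ 0 + κ 1) by ring]
  field_simp

end WaringVoid

/-! ### Measures from set functions on bounded Borel sets -/

/-- A set function that is countably additive on bounded Borel sets is the restriction of a Borel
measure. -/
theorem exists_measure_eq_of_isBounded {S : Type*} [MetricSpace S] [MeasurableSpace S]
    [BorelSpace S] (m : Set S → ℝ≥0∞) (hempty : m ∅ = 0)
    (hm : ∀ A : ℕ → Set S, (∀ i, MeasurableSet (A i)) → IsBounded (⋃ i, A i) →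
      Pairwise (Function.onFun Disjoint A) → m (⋃ i, A i) = ∑' i, m (A i)) :
    ∃ μ : Measure S, ∀ A, MeasurableSet A → IsBounded A → μ A = m A := by
  rcases isEmpty_or_nonempty S with hS | ⟨⟨x₀⟩⟩
  · exact ⟨0, fun A _ _ => by simp [Set.eq_empty_of_isEmpty A, hempty]⟩
  -- The space is cut into countably many bounded Borel shells.
  set R : ℕ → Set S := disjointed fun n : ℕ => Metric.ball x₀ n with hR
  have hRm (n) : MeasurableSet (R n) := .disjointed (fun _ => measurableSet_ball) n
  have hRb (n) : IsBounded (R n) := Metric.isBounded_ball.subset (disjointed_subset _ n)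
  have hRU : ⋃ n, R n = univ := by rw [hR, iUnion_disjointed, Metric.iUnion_ball_nat]
  have hRd : Pairwise (Function.onFun Disjoint R) := disjoint_disjointed _
  refine ⟨Measure.ofMeasurable (fun A _ => ∑' n, m (A ∩ R n)) (by simp [hempty]) ?_, ?_⟩
  · intro A hA hd
    rw [ENNReal.tsum_comm]
    refine tsum_congr fun n => ?_
    rw [iUnion_inter, hm]
    · exact fun i => (hA i).inter (hRm n)
    · exact (hRb n).subset (iUnion_subset fun i => inter_subset_right)
    · exact fun i j hij => (hd hij).mono inter_subset_left inter_subset_left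
  · intro A hA hb
    rw [Measure.ofMeasurable_apply _ hA]
    have hAU : A = ⋃ n, A ∩ R n := by rw [← inter_iUnion, hRU, inter_univ]
    conv_rhs => rw [hAU]
    rw [hm]
    · exact fun i => hA.inter (hRm i)
    · rwa [← hAU]
    · exact fun i j hij => (hRd hij).mono inter_subset_right inter_subset_right

/-! ### Consistency of the parameters -/

section Consistency

variable {Ω S : Type*} [MeasurableSpace Ω] [MeasurableSpace S] {P : Measure Ω} {N : Ω → Measure S}
  {a k ρ : ℝ}

theorem HasWaringLaw.real_iUnion_eq_zero {l : ℕ} {A : Fin l → Set S} {m : Fin l → ℝ≥0}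
    (h : HasWaringLaw P N a k ρ A m) :
    P.real {ω | N ω (⋃ i, A i) = 0} = waringVoid a ρ (k * ∑ i, (m i : ℝ)) := by
  rw [Finset.mul_sum, ← mgwdPmf_zero, ← h 0]
  simp [measure_iUnion_null_iff]

variable [MetricSpace S]

theorem IsFidiFamily.pair {A B : Set S} (hA : MeasurableSet A) (hAb : IsBounded A)
    (hB : MeasurableSet B) (hBb : IsBounded B) (hd : Disjoint A B) : IsFidiFamily ![A, B] := by
  refine ⟨?_, ?_, ?_⟩
  · simp [Fin.forall_fin_two, hA, hB]
  · simp [Fin.forall_fin_two, hAb, hBb]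
  · intro i j hij
    fin_cases i <;> fin_cases j <;> first | exact absurd rfl hij | exact hd | exact hd.symm

theorem IsFidiFamily.singleton {A : Set S} (hA : MeasurableSet A) (hAb : IsBounded A) :
    IsFidiFamily ![A] :=
  ⟨by simpa using hA, by simpa using hAb, fun i j hij => absurd (Subsingleton.elim i j) hij⟩

/-- The void probability of a member of a pair is governed by the parameter of that member. -/
theorem HasWaringLaw.real_fst_eq_zero [IsProbabilityMeasure P] (ha : 0 < a) (hk : 0 < k)
    (hρ : 0 < ρ) (hN : IsPointProcess P N) {A B : Set S} (hF : IsFidiFamily ![A, B])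
    {m : Fin 2 → ℝ≥0} (h : HasWaringLaw P N a k ρ ![A, B] m) :
    P.real {ω | N ω A = 0} = waringVoid a ρ (k * m 0) := by
  have hA : MeasurableSet A := hF.1 0
  have hB : MeasurableSet B := hF.1 1
  have hBb : IsBounded B := hF.2.1 1
  have hNA : Measurable fun ω => N ω A := (Measure.measurable_coe hA).comp hN.measurable
  have hNB : Measurable fun ω => N ω B := (Measure.measurable_coe hB).comp hN.measurable
  have hev (n : ℕ) : {ω | ∀ i, N ω (![A, B] i) = ((Pi.single 1 n : Fin 2 → ℕ) i : ℝ≥0∞)} =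
      {ω | N ω A = 0 ∧ N ω B = n} := by
    ext ω
    simp [Fin.forall_fin_two]
  have hmeas (n : ℕ) : MeasurableSet {ω | N ω A = 0 ∧ N ω B = n} :=
    (hNA (measurableSet_singleton _)).inter (hNB (measurableSet_singleton _))
  -- Almost surely `N B` is a natural number, so its values partition the void event of `A`.
  have hae : {ω | N ω A = 0} =ᵐ[P] ⋃ n : ℕ, {ω | N ω A = 0 ∧ N ω B = n} := by
    filter_upwards [hN.integerValued, hN.boundedlyFinite] with ω h1 h2
    obtain ⟨c, hc⟩ := h1 B hB hBb
    have hc' := h2 B hB hBb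
    have hct : c ≠ ⊤ := by
      rintro rfl
      simp [hc] at hc'
    lift c to ℕ using hct
    refine propext ⟨fun h0 => mem_iUnion.2 ⟨c, h0, by simpa using hc⟩, fun h0 => ?_⟩
    obtain ⟨n, hn⟩ := mem_iUnion.1 h0
    exact hn.1
  have hdisj : Pairwise (Function.onFun Disjoint
      fun n : ℕ => {ω | N ω A = 0 ∧ N ω B = n}) := by
    intro i j hij
    refine Set.disjoint_left.2 fun ω hi hj => hij ?_
    exact_mod_cast hi.2.symm.trans hj.2
  have hs : HasSum (fun n : ℕ => P.real {ω | N ω A = 0 ∧ N ω B = n})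
      (P.real {ω | N ω A = 0}) := by
    rw [measureReal_congr hae]
    have hU := measure_iUnion (μ := P) hdisj hmeas
    rw [measureReal_def, hU, ENNReal.tsum_toReal_eq fun n => measure_ne_top _ _]
    exact ENNReal.hasSum_toReal (hU ▸ measure_ne_top _ _)
  refine hs.unique ?_
  have h' := hasSum_mgwdPmf_pair (κ := fun i => k * (m i : ℝ)) ha hρ fun j => by positivity
  simpa only [← h _, hev] using h'

/-- In an arbitrary family, the void probability of a member is governed by the parameter of that
member. The other members are lumped into their union `B`; the events that the member
has `p` points and `B` none, for `p = 0, 1`, determine the parameter in terms of the pair. -/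
theorem HasWaringLaw.real_eq_zero [IsProbabilityMeasure P] (ha : 0 < a) (hk : 0 < k)
    (hρ : 0 < ρ) (hN : IsPointProcess P N) (hfidi : HasWaringFidi P N a k ρ) {l : ℕ}
    {A : Fin l → Set S} (hF : IsFidiFamily A) {m : Fin l → ℝ≥0}
    (h : HasWaringLaw P N a k ρ A m) (i : Fin l) :
    P.real {ω | N ω (A i) = 0} = waringVoid a ρ (k * m i) := by
  set B : Set S := ⋃ j ∈ ({i}ᶜ : Set (Fin l)), A j with hB
  have hF' : IsFidiFamily ![A i, B] := by
    refine .pair (hF.1 i) (hF.2.1 i) (.biUnion (to_countable _) fun j _ => hF.1 j)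
      ((isBounded_biUnion (toFinite _)).2 fun j _ => hF.2.1 j) ?_
    simp only [hB, disjoint_iUnion_right]
    exact fun j hj => hF.2.2 (Ne.symm hj)
  obtain ⟨m', h'⟩ := hfidi 2 _ hF'
  rw [h'.real_fst_eq_zero ha hk hρ hN hF']
  have hpmf (p : ℕ) : mgwdPmf a ρ (fun j => k * (m j : ℝ)) (Pi.single i p) =
      mgwdPmf a ρ (fun j => k * (m' j : ℝ)) (Pi.single 0 p) := by
    rw [← h, ← h']
    congr 1
    ext ω
    have hBz : N ω B = 0 ↔ ∀ j, j ≠ i → N ω (A j) = 0 := by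
      simp [hB]
    simp only [mem_ofPred_eq, Fin.forall_fin_two, Matrix.cons_val_zero, Matrix.cons_val_one,
      Pi.single_eq_same, ne_eq, one_ne_zero, not_false_eq_true, Pi.single_eq_of_ne, Nat.cast_zero,
      hBz]
    constructor
    · intro hω
      exact ⟨by simpa using hω i, fun j hj => by simpa [hj] using hω j⟩
    · rintro ⟨h1, h2⟩ j
      by_cases hj : j = i
      · subst hj
        simpa using h1
      · simpa [hj] using h2 j hj
  have hsum : ∑ j, k * (m j : ℝ) = ∑ j, k * (m' j : ℝ) := by
    have h0 := hpmf 0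
    rw [Pi.single_zero, Pi.single_zero, mgwdPmf_zero, mgwdPmf_zero] at h0
    exact (waringVoid_strictAntiOn ha hρ).injOn (mem_Ici.2 (by positivity))
      (mem_Ici.2 (by positivity)) h0
  have h1 := hpmf 1
  rw [mgwdPmf_single, mgwdPmf_single, hsum] at h1
  have hg {x y : ℝ} (hx : 0 < x) (hy : 0 ≤ y) : 0 < gammaRising x y :=
    div_pos (Real.Gamma_pos_of_pos (by positivity)) (Real.Gamma_pos_of_pos hx)
  have hg1 := hg hρ (y := ∑ j, k * (m' j : ℝ)) (by positivity)
  have hg2 := hg (add_pos hρ ha) (y := ∑ j, k * (m' j : ℝ) + (1 : ℕ)) (by positivity)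
  have h2 := mul_left_cancel₀ (div_pos (mul_pos hg1 (by simpa using ha)) hg2).ne' h1
  simp only [ascPochhammer_one, Polynomial.eval_X, Nat.factorial_one, Nat.cast_one, div_one] at h2
  rw [h2]

end Consistency

/-! ### The parameter measure -/

theorem theorem5 {Ω : Type*} [MeasurableSpace Ω] {P : Measure Ω} [IsProbabilityMeasure P]
    {S : Type*} [MetricSpace S] [CompleteSpace S] [TopologicalSpace.SeparableSpace S]
    [MeasurableSpace S] [BorelSpace S]
    {a k ρ : ℝ} (ha : 0 < a) (hk : 0 < k) (hρ : 0 < ρ)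
    (N : Ω → Measure S) (hN : IsPointProcess P N) (hatoms : NoFixedAtoms P N)
    (hfidi : HasWaringFidi P N a k ρ) :
    ∃ μ : Measure S, BoundedlyFinite μ ∧ (∀ x : S, μ {x} = 0) ∧
      (∀ A : Set S, MeasurableSet A → Bornology.IsBounded A →
        P.real {ω | N ω A = 0} =
          gammaRising ρ (k * (μ A).toReal) / gammaRising (ρ + a) (k * (μ A).toReal)) ∧
      (∀ (l : ℕ) (A : Fin l → Set S) (m : Fin l → ℝ≥0), IsFidiFamily A →
        HasWaringLaw P N a k ρ A m → ∀ i, μ (A i) = (m i : ℝ≥0∞)) := by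
  have hinj {s t : ℝ≥0} (h : waringVoid a ρ (k * s) = waringVoid a ρ (k * t)) : s = t := by
    have := (waringVoid_strictAntiOn ha hρ).injOn (mem_Ici.2 (by positivity))
      (mem_Ici.2 (by positivity)) h
    exact_mod_cast mul_left_cancel₀ hk.ne' this
  -- The candidate for `μ` on bounded Borel sets; its values on other sets are irrelevant.
  have hex (A : Set S) : ∃ t : ℝ≥0, MeasurableSet A → IsBounded A →
      P.real {ω | N ω A = 0} = waringVoid a ρ (k * t) := by
    by_cases hA : MeasurableSet A ∧ IsBounded A
    · obtain ⟨m, hm⟩ := hfidi 1 _ (.singleton hA.1 hA.2)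
      refine ⟨m 0, fun _ _ => ?_⟩
      simpa using hm.real_eq_zero ha hk hρ hN hfidi (.singleton hA.1 hA.2) 0
    · exact ⟨0, fun h1 h2 => absurd ⟨h1, h2⟩ hA⟩
  choose m hm using hex
  have hlaw {l : ℕ} {A : Fin l → Set S} {t : Fin l → ℝ≥0} (hF : IsFidiFamily A)
      (h : HasWaringLaw P N a k ρ A t) (i : Fin l) : m (A i) = t i :=
    hinj ((hm _ (hF.1 i) (hF.2.1 i)).symm.trans (h.real_eq_zero ha hk hρ hN hfidi hF i))
  have hempty : m ∅ = 0 := by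
    refine hinj ?_
    rw [← hm ∅ .empty isBounded_empty]
    simp [waringVoid_zero ha hρ]
  have hfin (l : ℕ) (A : Fin l → Set S) (hF : IsFidiFamily A) : m (⋃ i, A i) = ∑ i, m (A i) := by
    obtain ⟨t, ht⟩ := hfidi l A hF
    refine hinj ?_
    rw [← hm _ (.iUnion hF.1) (isBounded_iUnion.2 hF.2.1), ht.real_iUnion_eq_zero]
    simp [hlaw hF ht]
  have hmono {A B : Set S} (hA : MeasurableSet A) (hB : MeasurableSet B) (hBb : IsBounded B)
      (hAB : A ⊆ B) : m A ≤ m B := by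
    refine NNReal.coe_le_coe.1 (le_of_mul_le_mul_left ?_ hk)
    refine ((waringVoid_strictAntiOn ha hρ).le_iff_ge (mem_Ici.2 (by positivity))
      (mem_Ici.2 (by positivity))).1 ?_
    rw [← hm A hA (hBb.subset hAB), ← hm B hB hBb]
    exact measureReal_mono fun ω hω => measure_mono_null hAB hω
  -- Countable additivity: the void events of the partial unions decrease to that of the union.
  have hcount (A : ℕ → Set S) (hA : ∀ i, MeasurableSet (A i)) (hb : IsBounded (⋃ i, A i))
      (hd : Pairwise (Function.onFun Disjoint A)) : HasSum (fun i => m (A i)) (m (⋃ i, A i)) := by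
    set U : ℕ → Set S := fun n => ⋃ i : Fin n, A i with hU
    have hUm (n) : MeasurableSet (U n) := .iUnion fun i => hA i
    have hUs (n) : U n ⊆ ⋃ i, A i := iUnion_subset fun i => subset_iUnion A i
    have hmU (n) : m (U n) = ∑ i ∈ Finset.range n, m (A i) := by
      rw [hU, hfin n (fun i => A i) ⟨fun i => hA i, fun i => hb.subset (subset_iUnion A i),
        fun i j hij => hd (Fin.val_ne_of_ne hij)⟩, Finset.sum_range]
    have hle (n) : ∑ i ∈ Finset.range n, m (A i) ≤ m (⋃ i, A i) :=
      hmU n ▸ hmono (hUm n) (.iUnion hA) hb (hUs n)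
    have hsum : Summable fun i => m (A i) := NNReal.summable_of_sum_range_le hle
    have hlim := hsum.hasSum.tendsto_sum_nat
    have hI : ⋂ n, {ω | N ω (U n) = 0} = {ω | N ω (⋃ i, A i) = 0} := by
      ext ω
      simp only [mem_iInter, mem_ofPred_eq, hU, measure_iUnion_null_iff]
      exact ⟨fun h i => h (i + 1) ⟨i, by omega⟩, fun h n i => h i⟩
    have hP : Tendsto (fun n => P.real {ω | N ω (U n) = 0}) atTop
        (𝓝 (P.real {ω | N ω (⋃ i, A i) = 0})) := by
      rw [← hI]
      refine (ENNReal.tendsto_toReal (measure_ne_top _ _)).comp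
        (tendsto_measure_iInter_atTop (fun n => ?_) ?_ ⟨0, measure_ne_top _ _⟩)
      · exact (((Measure.measurable_coe (hUm n)).comp hN.measurable)
          (measurableSet_singleton _)).nullMeasurableSet
      · intro i j hij ω hω
        exact measure_mono_null
          (iUnion_subset fun x => subset_iUnion_of_subset (Fin.castLE hij x) subset_rfl) hω
    have hP' : Tendsto (fun n => P.real {ω | N ω (U n) = 0}) atTop
        (𝓝 (waringVoid a ρ (k * (∑' i, m (A i) : ℝ≥0)))) := by
      simp_rw [fun n => hm (U n) (hUm n) (hb.subset (hUs n)), hmU]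
      exact (continuousAt_waringVoid ha hρ (by positivity)).tendsto.comp
        ((NNReal.tendsto_coe.2 hlim).const_mul k)
    have := tendsto_nhds_unique hP hP'
    rw [hm _ (.iUnion hA) hb] at this
    rw [hinj this]
    exact hsum.hasSum
  obtain ⟨μ, hμ⟩ := exists_measure_eq_of_isBounded (fun A => (m A : ℝ≥0∞)) (by simp [hempty])
    fun A hA hb hd => (ENNReal.hasSum_coe.2 (hcount A hA hb hd)).tsum_eq.symm
  refine ⟨μ, fun A hA hb => by simp [hμ A hA hb], fun x => ?_, fun A hA hb => ?_,
    fun l A t hF h i => ?_⟩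
  · have hx : m {x} = 0 := by
      refine hinj ?_
      rw [← hm _ (measurableSet_singleton x) isBounded_singleton]
      have hc : {ω | N ω {x} = 0} = {ω | 0 < N ω {x}}ᶜ := by
        ext ω
        simp
      rw [hc, NNReal.coe_zero, mul_zero, waringVoid_zero ha hρ, measureReal_def,
        (prob_compl_eq_one_iff₀ ?_).2 (hatoms x), ENNReal.toReal_one]
      exact NullMeasurableSet.of_null (hatoms x)
    simp [hμ _ (measurableSet_singleton x) isBounded_singleton, hx]
  · rw [hm A hA hb, hμ A hA hb, ENNReal.coe_toReal, waringVoid]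
  · rw [hμ _ (hF.1 i) (hF.2.1 i), hlaw hF h i]
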